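/- A Cantor set of points in $\mathbb{R}$ is a nonempty, compact, perfect, totally disconnected set $C\subset\mathbb{R}$. A point $x\in C$ is an end point of $C$ if there is $\delta>0$ such that either $(x,x+\delta)\cap C=\emptyset$ or $(x-\delta,x)\cap C=\emptyset$. A set $X\subset\mathbb{R}^2$ is called a straight hairy Cantor set if there are a Cantor set of points $C\subset\mathbb{R}$ and a function $l:C\to[0,+\infty)$ such that \[X=\{(x,y)\in\mathbb{R}^2 \mid x\in C,\ 0\le y\le l(x)\}\] and the following hold: (i) the set of $x\in C$ with $l(x)>0$ is dense in $C$; (ii) if $x\in C$ is an end point, then $l(x)=0=\limsup_{t\to x,\,t\in C}l(t)$; (iii) if $x\in C$ is not an end point, then $\limsup_{t\to x^-,\,t\in C}l(t)=\limsup_{t\to x^+,\,t\in C}l(t)=l(x)$. Two subsets of $\mathbb{R}^2$ are ambiently homeomorphic if there is a homeomorphism of $\mathbb{R}^2$ that maps one onto the other. **Theorem.** Any two straight hairy Cantor sets in the plane are ambiently homeomorphic. -/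

import Mathlib

open Set Filter Topology

/-- A Cantor set of points on the real line: a nonempty, compact, perfect, totally disconnected
subset of `ℝ`. -/
structure IsCantorSet (C : Set ℝ) : Prop where
  nonempty : C.Nonempty
  isCompact : IsCompact C
  preperfect : Preperfect C
  totallyDisconnected : IsTotallyDisconnected C

/-- `x` is an end point of `C`: it belongs to `C`, and `C` misses an interval immediately to the
right or immediately to the left of `x`. -/
def IsEndPoint (C : Set ℝ) (x : ℝ) : Prop :=
  x ∈ C ∧ ∃ δ : ℝ, 0 < δ ∧ (Ioo x (x + δ) ∩ C = ∅ ∨ Ioo (x - δ) x ∩ C = ∅)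

/-- `l` is a length function over `C`. Only the values of `l` on `C` are used.
Upper limits are taken in the extended reals, so that no boundedness is presupposed. -/
structure IsHairLength (C : Set ℝ) (l : ℝ → ℝ) : Prop where
  nonneg : ∀ x ∈ C, 0 ≤ l x
  dense_pos : C ⊆ closure {x | x ∈ C ∧ 0 < l x}
  endPoint : ∀ x, IsEndPoint C x →
    l x = 0 ∧ limsup (fun t => (l t : EReal)) (𝓝[C \ {x}] x) = 0
  not_endPoint : ∀ x ∈ C, ¬ IsEndPoint C x →
    limsup (fun t => (l t : EReal)) (𝓝[C ∩ Iio x] x) = (l x : EReal) ∧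
    limsup (fun t => (l t : EReal)) (𝓝[C ∩ Ioi x] x) = (l x : EReal)

/-- A straight hairy Cantor set in the plane. -/
def IsStraightHairyCantorSet (X : Set (ℝ × ℝ)) : Prop :=
  ∃ (C : Set ℝ) (l : ℝ → ℝ), IsCantorSet C ∧ IsHairLength C l ∧
    X = {p : ℝ × ℝ | p.1 ∈ C ∧ 0 ≤ p.2 ∧ p.2 ≤ l p.1}

/-- Two subsets of the plane are ambiently homeomorphic if some homeomorphism of the plane maps
the first onto the second. -/
def AmbientlyHomeomorphic (X Y : Set (ℝ × ℝ)) : Prop :=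
  ∃ h : (ℝ × ℝ) ≃ₜ (ℝ × ℝ), h '' X = Y

/-! Extended by zero, a length function has its Cantor set as `tsupport`. It therefore suffices to
conjugate two such functions `l`, `m` by an increasing homeomorphism `φ` of the line and a positive
factor: `m (φ x) = exp (r x) * l x`, with `r` continuous on the support. Once `r` is extended to the
line by Tietze, `(x, y) ↦ (φ x, exp (r x) * y)` is the required map of the plane.

Both `φ` and `r` come from a back-and-forth subdivision into matched boxes. When the first interval
is cut off the support, one piece keeps the full supremum. Since every height is approximated from
both sides, the second interval can be cut so that the corresponding piece keeps its full supremum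
and the other has almost the right one (`MatchedBox.exists_split`). The change of `r` at stage `n`
is at most `2⁻ⁿ`, so `r` converges uniformly over all branches. Both sides shrink to points, and by
upper semicontinuity the suprema tend to `l x` and `m (φ x)`. Box ends avoid the supports, which
makes the limit of `r` continuous there (`MatchedBox.exists_conjugation`). -/

/-! ### Height functions and cuts of intervals -/

/-- A height function on the whole line: upper semicontinuous, compactly supported, with
nowhere dense support, and whose value at each point is the upper limit from either side. -/
structure IsHairFunction (l : ℝ → ℝ) : Prop where
  nonneg : ∀ x, 0 ≤ l x
  usc : UpperSemicontinuous l
  left : ∀ x w, w < l x → ∀ z < x, ∃ y ∈ Ioo z x, w < l y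
  right : ∀ x w, w < l x → ∀ z > x, ∃ y ∈ Ioo x z, w < l y
  hasCompactSupport : HasCompactSupport l
  dense : Dense (tsupport l)ᶜ
  exists_pos : ∃ x, 0 < l x

/-- The supremum of `l` over the closed interval from `a` to `b`. -/
noncomputable def supOn (l : ℝ → ℝ) (a b : ℝ) : ℝ := sSup (l '' Icc a b)

namespace IsHairFunction

variable {l : ℝ → ℝ}

theorem bddAbove (h : IsHairFunction l) : BddAbove (range l) := by
  obtain ⟨B, hB⟩ := UpperSemicontinuousOn.bddAbove_of_isCompact h.hasCompactSupport
    (h.usc.upperSemicontinuousOn _)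
  refine ⟨max B 0, ?_⟩
  rintro _ ⟨x, rfl⟩
  by_cases hx : x ∈ tsupport l
  · exact (hB ⟨x, hx, rfl⟩).trans (le_max_left _ _)
  · rw [image_eq_zero_of_notMem_tsupport hx]
    exact le_max_right _ _

theorem le_supOn (h : IsHairFunction l) {a b x : ℝ} (hx : x ∈ Icc a b) : l x ≤ supOn l a b :=
  le_csSup (h.bddAbove.mono (image_subset_range _ _)) ⟨x, hx, rfl⟩

theorem supOn_nonneg (h : IsHairFunction l) (a b : ℝ) : 0 ≤ supOn l a b :=
  Real.sSup_nonneg (by rintro _ ⟨x, -, rfl⟩; exact h.nonneg x)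

theorem supOn_le {a b v : ℝ} (hv : 0 ≤ v) (H : ∀ x ∈ Icc a b, l x ≤ v) : supOn l a b ≤ v :=
  Real.sSup_le (by rintro _ ⟨x, hx, rfl⟩; exact H x hx) hv

theorem exists_lt_of_lt_supOn {a b v : ℝ} (hv : 0 ≤ v) (H : v < supOn l a b) :
    ∃ x ∈ Icc a b, v < l x := by
  by_contra! hc
  exact absurd (supOn_le hv hc) (not_le.2 H)

theorem supOn_split (h : IsHairFunction l) {a b c : ℝ} (hc : c ∈ Icc a b) :
    supOn l a b = max (supOn l a c) (supOn l c b) := by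
  apply le_antisymm
  · refine supOn_le (le_max_of_le_left (h.supOn_nonneg _ _)) fun x hx => ?_
    rcases le_total x c with hxc | hxc
    · exact (h.le_supOn ⟨hx.1, hxc⟩).trans (le_max_left _ _)
    · exact (h.le_supOn ⟨hxc, hx.2⟩).trans (le_max_right _ _)
  · refine max_le (supOn_le (h.supOn_nonneg _ _) fun x hx => ?_)
      (supOn_le (h.supOn_nonneg _ _) fun x hx => ?_)
    · exact h.le_supOn ⟨hx.1, hx.2.trans hc.2⟩
    · exact h.le_supOn ⟨hc.1.trans hx.1, hx.2⟩

theorem exists_notMem_tsupport (h : IsHairFunction l) {a b : ℝ} (hab : a < b) :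
    ∃ c ∈ Ioo a b, c ∉ tsupport l := by
  obtain ⟨c, hc, hc'⟩ := h.dense.exists_mem_open isOpen_Ioo (nonempty_Ioo.2 hab)
  exact ⟨c, hc', hc⟩

theorem isCompact_level (h : IsHairFunction l) (a b w : ℝ) :
    IsCompact (Icc a b ∩ l ⁻¹' Ici w) :=
  isCompact_Icc.inter_right (h.usc.isClosed_preimage w)

/-- Cutting an interval so that the left part has a prescribed approximate height and the right
part keeps the full height. -/
theorem exists_cut_left (h : IsHairFunction l) {a b v w : ℝ} (hab : a < b)
    (ha : a ∉ tsupport l) (hv : v ≤ supOn l a b) (hw : w < v ∨ w = 0 ∧ v = 0) (hw0 : 0 ≤ w) :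
    ∃ d ∈ Ioo a b, d ∉ tsupport l ∧ w ≤ supOn l a d ∧ supOn l a d ≤ v ∧
      supOn l d b = supOn l a b := by
  rcases hw with hw | ⟨rfl, rfl⟩
  -- Let `e` be the first point of height at least `u`. Heights before `e` are below `u`, yet some
  -- arbitrarily near `e` exceed `w`; the cut goes between such a point and `e`.
  · obtain ⟨u, hwu, huv⟩ := exists_between hw
    obtain ⟨x, hx, hux⟩ := exists_lt_of_lt_supOn (hw0.trans hwu.le) (huv.trans_le hv)
    obtain ⟨e, ⟨he, heu⟩, hmin⟩ := (h.isCompact_level a b u).exists_isLeast ⟨x, hx, hux.le⟩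
    rw [mem_preimage, mem_Ici] at heu
    have hae : a < e := by
      refine lt_of_le_of_ne he.1 ?_
      rintro rfl
      rw [image_eq_zero_of_notMem_tsupport ha] at heu
      linarith
    obtain ⟨y, hy, hwy⟩ := h.left e w (hwu.trans_le heu) a hae
    obtain ⟨d, hd, hdl⟩ := h.exists_notMem_tsupport hy.2
    have hle : supOn l a d ≤ u := by
      refine supOn_le (hw0.trans hwu.le) fun z hz => ?_
      by_contra! hc
      have := hmin ⟨⟨hz.1, by linarith [hz.2, hd.2, he.2]⟩, hc.le⟩
      linarith [hz.2, hd.2]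
    have hdI : d ∈ Ioo a b := ⟨hy.1.trans hd.1, hd.2.trans_le he.2⟩
    refine ⟨d, hdI, hdl, hwy.le.trans (h.le_supOn ⟨hy.1.le, hd.1.le⟩), hle.trans huv.le, ?_⟩
    have hmax := h.supOn_split (Ioo_subset_Icc_self hdI)
    -- The left part cannot carry the maximum: its supremum is at most `u < v`.
    rcases max_choice (supOn l a d) (supOn l d b) with hm | hm
    · linarith
    · rw [hmax, hm]
  -- For `w = v = 0`, cut so close to `a` that the left part misses the support.
  · obtain ⟨e, hae, he⟩ := mem_nhdsGE_iff_exists_Icc_subset.1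
      (mem_nhdsWithin_of_mem_nhds ((isClosed_tsupport l).isOpen_compl.mem_nhds ha))
    obtain ⟨d, had, hd⟩ := exists_between (lt_min hae hab)
    have hdI : d ∈ Ioo a b := ⟨had, hd.trans_le (min_le_right _ _)⟩
    have hde : d ≤ e := (hd.trans_le (min_le_left _ _)).le
    have hle : supOn l a d ≤ 0 := supOn_le le_rfl fun z hz =>
      (image_eq_zero_of_notMem_tsupport (he ⟨hz.1, hz.2.trans hde⟩)).le
    refine ⟨d, hdI, he ⟨had.le, hde⟩, h.supOn_nonneg _ _, hle, ?_⟩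
    rw [h.supOn_split (Ioo_subset_Icc_self hdI),
      max_eq_right (hle.trans (h.supOn_nonneg _ _))]

theorem tsupport_comp_neg (l : ℝ → ℝ) :
    tsupport (fun x => l (-x)) = (Homeomorph.neg ℝ) ⁻¹' tsupport l := by
  rw [tsupport, tsupport, (Homeomorph.neg ℝ).preimage_closure]
  rfl

theorem comp_neg (h : IsHairFunction l) : IsHairFunction fun x => l (-x) := by
  have hts := tsupport_comp_neg l
  refine ⟨fun x => h.nonneg _, fun x w hw => ?_, fun x w hw z hz => ?_, fun x w hw z hz => ?_,
    ?_, ?_, ?_⟩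
  · exact (continuous_neg.tendsto x).eventually (h.usc (-x) w hw)
  · obtain ⟨y, hy, hwy⟩ := h.right (-x) w hw (-z) (neg_lt_neg hz)
    exact ⟨-y, ⟨by linarith [hy.2], by linarith [hy.1]⟩, by simpa using hwy⟩
  · obtain ⟨y, hy, hwy⟩ := h.left (-x) w hw (-z) (neg_lt_neg hz)
    exact ⟨-y, ⟨by linarith [hy.2], by linarith [hy.1]⟩, by simpa using hwy⟩
  · rw [HasCompactSupport, hts]
    exact (Homeomorph.neg ℝ).isCompact_preimage.2 h.hasCompactSupport
  · rw [hts, ← preimage_compl]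
    exact h.dense.preimage (Homeomorph.neg ℝ).isOpenMap
  · obtain ⟨x, hx⟩ := h.exists_pos
    exact ⟨-x, by simpa using hx⟩

theorem supOn_comp_neg (l : ℝ → ℝ) (a b : ℝ) :
    supOn (fun x => l (-x)) a b = supOn l (-b) (-a) := by
  rw [supOn, supOn, ← image_neg_Icc, image_image]

/-- The mirror image of `exists_cut_left`. -/
theorem exists_cut_right (h : IsHairFunction l) {a b v w : ℝ} (hab : a < b)
    (hb : b ∉ tsupport l) (hv : v ≤ supOn l a b) (hw : w < v ∨ w = 0 ∧ v = 0) (hw0 : 0 ≤ w) :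
    ∃ d ∈ Ioo a b, d ∉ tsupport l ∧ w ≤ supOn l d b ∧ supOn l d b ≤ v ∧
      supOn l a d = supOn l a b := by
  have hts : ∀ x, x ∈ tsupport (fun x => l (-x)) ↔ -x ∈ tsupport l := by
    intro x
    rw [tsupport_comp_neg]
    rfl
  obtain ⟨d, hd, h1, h2, h3, h4⟩ := h.comp_neg.exists_cut_left (neg_lt_neg hab)
    (by rwa [hts, neg_neg]) (by rwa [supOn_comp_neg, neg_neg, neg_neg]) hw hw0
  simp only [supOn_comp_neg, neg_neg] at h2 h3 h4
  exact ⟨-d, ⟨by linarith [hd.2], by linarith [hd.1]⟩, by rwa [hts] at h1, h2, h3, h4⟩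

end IsHairFunction

/-! ### Matched boxes and their splitting -/

/-- A pair of intervals with end points off the supports, over which the heights of `l` and `m`
are proportional, with factor `exp r`. -/
structure MatchedBox (l m : ℝ → ℝ) where
  (a b a' b' r : ℝ)
  lt : a < b
  lt' : a' < b'
  a_notMem : a ∉ tsupport l
  b_notMem : b ∉ tsupport l
  a'_notMem : a' ∉ tsupport m
  b'_notMem : b' ∉ tsupport m
  supOn_eq : supOn m a' b' = Real.exp r * supOn l a b

variable {l m : ℝ → ℝ}

/-- Exchange of the two sides of a box. -/
def MatchedBox.swap (N : MatchedBox l m) : MatchedBox m l where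
  a := N.a'
  b := N.b'
  a' := N.a
  b' := N.b
  r := -N.r
  lt := N.lt'
  lt' := N.lt
  a_notMem := N.a'_notMem
  b_notMem := N.b'_notMem
  a'_notMem := N.a_notMem
  b'_notMem := N.b_notMem
  supOn_eq := by rw [N.supOn_eq, ← mul_assoc, ← Real.exp_add, neg_add_cancel, Real.exp_zero, one_mul]

/-- The boxes `L` and `R` are adjacent, make up `N`, and have nearly the same factor. -/
structure IsSplit (ε : ℝ) (N L R : MatchedBox l m) : Prop where
  left_a : L.a = N.a
  mid : L.b = R.a
  right_b : R.b = N.b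
  left_a' : L.a' = N.a'
  mid' : L.b' = R.a'
  right_b' : R.b' = N.b'
  left_r : |L.r - N.r| ≤ ε
  right_r : |R.r - N.r| ≤ ε

theorem IsSplit.swap {ε : ℝ} {N L R : MatchedBox l m} (h : IsSplit ε N L R) :
    IsSplit ε N.swap L.swap R.swap where
  left_a := h.left_a'
  mid := h.mid'
  right_b := h.right_b'
  left_a' := h.left_a
  mid' := h.mid
  right_b' := h.right_b
  left_r := by
    have := h.left_r
    rwa [abs_sub_comm, ← neg_sub_neg] at this
  right_r := by
    have := h.right_r
    rwa [abs_sub_comm, ← neg_sub_neg] at this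

theorem exists_factor {r ε p q : ℝ} (hε : 0 ≤ ε) (hp : 0 ≤ p)
    (h1 : Real.exp (r - ε) * p ≤ q) (h2 : q ≤ Real.exp r * p) :
    ∃ s, |s - r| ≤ ε ∧ q = Real.exp s * p := by
  rcases hp.eq_or_lt with rfl | hp
  · refine ⟨r, by simpa using hε, ?_⟩
    rw [mul_zero] at *
    exact le_antisymm h2 h1
  · have hq : 0 < q := lt_of_lt_of_le (by positivity) h1
    refine ⟨Real.log (q / p), ?_, ?_⟩
    · rw [← le_div_iff₀ hp, ← Real.le_log_iff_exp_le (by positivity)] at h1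
      rw [← div_le_iff₀ hp, ← Real.log_le_iff_le_exp (by positivity)] at h2
      rw [abs_le]
      constructor <;> linarith
    · rw [Real.exp_log (by positivity), div_mul_cancel₀ _ hp.ne']

/-- The piece with the full supremum can keep the factor `N.r` exactly; only the lower piece needs
an adjustment, by at most `ε`. -/
theorem MatchedBox.exists_split (hl : IsHairFunction l) (hm : IsHairFunction m)
    (N : MatchedBox l m) {c ε : ℝ} (hc : c ∈ Ioo N.a N.b) (hcl : c ∉ tsupport l) (hε : 0 < ε) :
    ∃ L R : MatchedBox l m, IsSplit ε N L R ∧ L.b = c := by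
  have hsplit := hl.supOn_split (Ioo_subset_Icc_self hc)
  -- The second alternative covers a lower piece that carries no hairs.
  have key : ∀ p, 0 ≤ p → Real.exp (N.r - ε) * p < Real.exp N.r * p ∨
      Real.exp (N.r - ε) * p = 0 ∧ Real.exp N.r * p = 0 := by
    intro p hp
    rcases hp.eq_or_lt with rfl | hp
    · simp
    · left
      have : Real.exp (N.r - ε) < Real.exp N.r := Real.exp_lt_exp.2 (by linarith)
      gcongr
  have hN := N.supOn_eq
  rcases le_total (supOn l N.a c) (supOn l c N.b) with hle | hle
  · rw [max_eq_right hle] at hsplit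
    have hp := hl.supOn_nonneg N.a c
    obtain ⟨d, hd, hdm, h1, h2, h3⟩ := hm.exists_cut_left N.lt' N.a'_notMem
      (v := Real.exp N.r * supOn l N.a c)
      (by rw [hN, hsplit]; gcongr) (key _ hp) (by positivity)
    obtain ⟨s, hs, hs'⟩ := exists_factor hε.le hp h1 h2
    exact ⟨⟨N.a, c, N.a', d, s, hc.1, hd.1, N.a_notMem, hcl, N.a'_notMem, hdm, hs'⟩,
      ⟨c, N.b, d, N.b', N.r, hc.2, hd.2, hcl, N.b_notMem, hdm, N.b'_notMem,
        by rw [h3, hN, hsplit]⟩,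
      ⟨rfl, rfl, rfl, rfl, rfl, rfl, hs, by simpa using hε.le⟩, rfl⟩
  · rw [max_eq_left hle] at hsplit
    have hp := hl.supOn_nonneg c N.b
    obtain ⟨d, hd, hdm, h1, h2, h3⟩ := hm.exists_cut_right N.lt' N.b'_notMem
      (v := Real.exp N.r * supOn l c N.b)
      (by rw [hN, hsplit]; gcongr) (key _ hp) (by positivity)
    obtain ⟨s, hs, hs'⟩ := exists_factor hε.le hp h1 h2
    exact ⟨⟨N.a, c, N.a', d, N.r, hc.1, hd.1, N.a_notMem, hcl, N.a'_notMem, hdm,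
        by rw [h3, hN, hsplit]⟩,
      ⟨c, N.b, d, N.b', s, hc.2, hd.2, hcl, N.b_notMem, hdm, N.b'_notMem, hs'⟩,
      ⟨rfl, rfl, rfl, rfl, rfl, rfl, by simpa using hε.le, hs⟩, rfl⟩

theorem MatchedBox.exists_split_short (hl : IsHairFunction l) (hm : IsHairFunction m)
    (N : MatchedBox l m) {ε : ℝ} (hε : 0 < ε) :
    ∃ L R : MatchedBox l m, IsSplit ε N L R ∧
      L.b - L.a ≤ 2 / 3 * (N.b - N.a) ∧ R.b - R.a ≤ 2 / 3 * (N.b - N.a) := by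
  have := N.lt
  -- A cut in the middle third leaves at most two thirds on either side.
  obtain ⟨c, hc, hcl⟩ := hl.exists_notMem_tsupport
    (by linarith : N.a + (N.b - N.a) / 3 < N.b - (N.b - N.a) / 3)
  obtain ⟨L, R, h, rfl⟩ := N.exists_split hl hm
    (c := c) ⟨by linarith [hc.1], by linarith [hc.2]⟩ hcl hε
  refine ⟨L, R, h, ?_, ?_⟩
  · rw [h.left_a]; linarith [hc.2]
  · rw [h.right_b, ← h.mid]; linarith [hc.1]

/-- A rule for repeatedly splitting matched boxes, halving alternately the first and the second
side. -/
structure SplitRule (l m : ℝ → ℝ) where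
  (left right : ℕ → MatchedBox l m → MatchedBox l m)
  isSplit : ∀ n N, IsSplit ((1 / 2) ^ n) N (left n N) (right n N)
  even : ∀ n N, Even n → (left n N).b - (left n N).a ≤ 2 / 3 * (N.b - N.a) ∧
    (right n N).b - (right n N).a ≤ 2 / 3 * (N.b - N.a)
  odd : ∀ n N, ¬ Even n → (left n N).b' - (left n N).a' ≤ 2 / 3 * (N.b' - N.a') ∧
    (right n N).b' - (right n N).a' ≤ 2 / 3 * (N.b' - N.a')

theorem IsHairFunction.nonempty_splitRule (hl : IsHairFunction l) (hm : IsHairFunction m) :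
    Nonempty (SplitRule l m) := by
  have H : ∀ (n : ℕ) (N : MatchedBox l m), ∃ L R : MatchedBox l m,
      IsSplit ((1 / 2) ^ n) N L R ∧
      (Even n → L.b - L.a ≤ 2 / 3 * (N.b - N.a) ∧ R.b - R.a ≤ 2 / 3 * (N.b - N.a)) ∧
      (¬ Even n → L.b' - L.a' ≤ 2 / 3 * (N.b' - N.a') ∧
        R.b' - R.a' ≤ 2 / 3 * (N.b' - N.a')) := by
    intro n N
    have hε : (0 : ℝ) < (1 / 2) ^ n := by positivity
    by_cases hn : Even n
    · obtain ⟨L, R, h, h1⟩ := N.exists_split_short hl hm hε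
      exact ⟨L, R, h, fun _ => h1, fun h' => absurd hn h'⟩
    -- At odd stages the second side is cut first, by exchanging the roles of `l` and `m`.
    · obtain ⟨L, R, h, h1⟩ := N.swap.exists_split_short hm hl hε
      have := h.swap
      refine ⟨L.swap, R.swap, ?_, fun h' => absurd h' hn, fun _ => h1⟩
      convert this using 1
      cases N
      simp [MatchedBox.swap]
  choose L R h h1 h2 using H
  exact ⟨⟨L, R, h, h1, h2⟩⟩

/-! ### Nested intervals -/

theorem tendsto_zero_of_two_step {u : ℕ → ℝ} (hu : Antitone u) (h0 : ∀ n, 0 ≤ u n)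
    (h : ∀ n, u (n + 2) ≤ 2 / 3 * u n) : Tendsto u atTop (𝓝 0) := by
  have hlim := tendsto_atTop_ciInf hu ⟨0, by rintro _ ⟨n, rfl⟩; exact h0 n⟩
  have h1 := le_of_tendsto_of_tendsto' ((tendsto_add_atTop_iff_nat 2).2 hlim)
    (hlim.const_mul (2 / 3)) h
  have h2 := ge_of_tendsto' hlim h0
  rwa [show ⨅ n, u n = 0 by linarith] at hlim

theorem eq_of_mem_nested {a b : ℕ → ℝ} (h : Tendsto (fun n => b n - a n) atTop (𝓝 0)) {x y : ℝ}
    (hx : ∀ n, x ∈ Ico (a n) (b n)) (hy : ∀ n, y ∈ Ico (a n) (b n)) : x = y := by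
  have : |x - y| ≤ 0 := ge_of_tendsto' h fun n => by
    rw [abs_le]
    constructor <;> linarith [(hx n).1, (hx n).2, (hy n).1, (hy n).2]
  exact sub_eq_zero.1 (abs_nonpos_iff.1 this)

/-- If two nested sequences of intervals shrink simultaneously on the right and the first of them
shrinks to a point, then the half-open intervals of the second have a common point. -/
theorem exists_mem_nested {a b a' b' : ℕ → ℝ} (ha' : Monotone a') (hb' : Antitone b')
    (hab' : ∀ n, a' n < b' n) (hb : ∀ n, b (n + 1) = b n ∨ b' (n + 1) < b' n)
    (h : Tendsto (fun n => b n - a n) atTop (𝓝 0)) {x : ℝ} (hx : ∀ n, x ∈ Ico (a n) (b n)) :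
    ∃ y, ∀ n, y ∈ Ico (a' n) (b' n) := by
  have hle : ∀ k n, a' k ≤ b' n := fun k n =>
    (ha' (le_max_left k n)).trans ((hab' _).le.trans (hb' (le_max_right k n)))
  have hsup : ∀ n, ⨆ k, a' k ≤ b' n := fun n => ciSup_le fun k => hle k n
  refine ⟨⨆ k, a' k, fun n => ⟨le_ciSup (f := a') ⟨b' 0, ?_⟩ n, ?_⟩⟩
  · rintro _ ⟨k, rfl⟩
    exact hle k 0
  · by_contra! hc
    -- If the supremum reaches `b' n`, then `b'` can no longer drop, hence neither can `b`. This
    -- forces `b n - x ≤ 0`, against `x < b n`.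
    have hconst : ∀ k, b (n + k) = b n := by
      intro k
      induction k with
      | zero => rfl
      | succ k ih =>
        rcases hb (n + k) with h1 | h1
        · rw [← ih, ← h1, add_assoc]
        · have := hsup (n + k + 1)
          have := hb' (Nat.le_add_right n k)
          linarith
    have := ge_of_tendsto ((tendsto_add_atTop_iff_nat n).2 h) (Eventually.of_forall fun k =>
      (by
        have h1 := hconst k
        rw [add_comm] at h1
        have := (hx (k + n)).1
        show b n - x ≤ b (k + n) - a (k + n)
        linarith))
    linarith [(hx n).2]

/-! ### Branches of the subdivision -/

namespace SplitRule

variable (T : SplitRule l m) (N₀ : MatchedBox l m)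

open Classical in
/-- The branch of boxes that goes left when the left box satisfies `p`, and right otherwise. -/
noncomputable def branch (p : MatchedBox l m → Prop) : ℕ → MatchedBox l m
  | 0 => N₀
  | n + 1 => if p (T.left n (branch p n)) then T.left n (branch p n)
      else T.right n (branch p n)

variable {T N₀} {p : MatchedBox l m → Prop} {n : ℕ}

theorem branch_succ_of_pos (h : p (T.left n (T.branch N₀ p n))) :
    T.branch N₀ p (n + 1) = T.left n (T.branch N₀ p n) := if_pos h

theorem branch_succ_of_neg (h : ¬ p (T.left n (T.branch N₀ p n))) :
    T.branch N₀ p (n + 1) = T.right n (T.branch N₀ p n) := if_neg h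

theorem branch_succ (T : SplitRule l m) (N₀ : MatchedBox l m) (p : MatchedBox l m → Prop) (n : ℕ) :
    T.branch N₀ p (n + 1) = T.left n (T.branch N₀ p n) ∨
      T.branch N₀ p (n + 1) = T.right n (T.branch N₀ p n) := by
  by_cases h : p (T.left n (T.branch N₀ p n))
  · exact Or.inl (branch_succ_of_pos h)
  · exact Or.inr (branch_succ_of_neg h)

/-- One step down a branch moves either the right ends or the left ends inwards. -/
theorem branch_step (T : SplitRule l m) (N₀ : MatchedBox l m) (p : MatchedBox l m → Prop) (n : ℕ) :
    ((T.branch N₀ p (n + 1)).a = (T.branch N₀ p n).a ∧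
      (T.branch N₀ p (n + 1)).a' = (T.branch N₀ p n).a' ∧
      (T.branch N₀ p (n + 1)).b < (T.branch N₀ p n).b ∧
      (T.branch N₀ p (n + 1)).b' < (T.branch N₀ p n).b') ∨
    ((T.branch N₀ p n).a < (T.branch N₀ p (n + 1)).a ∧
      (T.branch N₀ p n).a' < (T.branch N₀ p (n + 1)).a' ∧
      (T.branch N₀ p (n + 1)).b = (T.branch N₀ p n).b ∧
      (T.branch N₀ p (n + 1)).b' = (T.branch N₀ p n).b') := by
  have h := T.isSplit n (T.branch N₀ p n)
  rcases T.branch_succ N₀ p n with h1 | h1 <;> rw [h1]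
  · refine Or.inl ⟨h.left_a, h.left_a', ?_, ?_⟩
    · rw [h.mid, ← h.right_b]; exact MatchedBox.lt _
    · rw [h.mid', ← h.right_b']; exact MatchedBox.lt' _
  · refine Or.inr ⟨?_, ?_, h.right_b, h.right_b'⟩
    · rw [← h.mid, ← h.left_a]; exact MatchedBox.lt _
    · rw [← h.mid', ← h.left_a']; exact MatchedBox.lt' _

theorem branch_a_mono (T : SplitRule l m) (N₀ : MatchedBox l m) (p : MatchedBox l m → Prop) :
    Monotone fun n => (T.branch N₀ p n).a :=
  monotone_nat_of_le_succ fun n => by rcases T.branch_step N₀ p n with h | h <;> linarith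

theorem branch_a'_mono (T : SplitRule l m) (N₀ : MatchedBox l m) (p : MatchedBox l m → Prop) :
    Monotone fun n => (T.branch N₀ p n).a' :=
  monotone_nat_of_le_succ fun n => by rcases T.branch_step N₀ p n with h | h <;> linarith

theorem branch_b_anti (T : SplitRule l m) (N₀ : MatchedBox l m) (p : MatchedBox l m → Prop) :
    Antitone fun n => (T.branch N₀ p n).b :=
  antitone_nat_of_succ_le fun n => by rcases T.branch_step N₀ p n with h | h <;> linarith

theorem branch_b'_anti (T : SplitRule l m) (N₀ : MatchedBox l m) (p : MatchedBox l m → Prop) :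
    Antitone fun n => (T.branch N₀ p n).b' :=
  antitone_nat_of_succ_le fun n => by rcases T.branch_step N₀ p n with h | h <;> linarith

theorem tendsto_length (T : SplitRule l m) (N₀ : MatchedBox l m) (p : MatchedBox l m → Prop) :
    Tendsto (fun n => (T.branch N₀ p n).b - (T.branch N₀ p n).a) atTop (𝓝 0) := by
  have hanti : Antitone fun n => (T.branch N₀ p n).b - (T.branch N₀ p n).a := fun i j hij =>
    sub_le_sub (T.branch_b_anti N₀ p hij) (T.branch_a_mono N₀ p hij)
  have heven : ∀ n, Even n → (T.branch N₀ p (n + 1)).b - (T.branch N₀ p (n + 1)).a ≤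
      2 / 3 * ((T.branch N₀ p n).b - (T.branch N₀ p n).a) := fun n hn => by
    have := T.even n (T.branch N₀ p n) hn
    rcases T.branch_succ N₀ p n with h | h <;> rw [h]
    exacts [this.1, this.2]
  refine tendsto_zero_of_two_step hanti (fun n => sub_nonneg.2 (MatchedBox.lt _).le) fun n => ?_
  by_cases hn : Even n
  · exact (hanti (Nat.le_succ (n + 1))).trans (heven n hn)
  · exact (heven (n + 1) (Nat.even_add_one.2 hn)).trans
      (mul_le_mul_of_nonneg_left (hanti (Nat.le_succ n)) (by norm_num))

theorem tendsto_length' (T : SplitRule l m) (N₀ : MatchedBox l m) (p : MatchedBox l m → Prop) :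
    Tendsto (fun n => (T.branch N₀ p n).b' - (T.branch N₀ p n).a') atTop (𝓝 0) := by
  have hanti : Antitone fun n => (T.branch N₀ p n).b' - (T.branch N₀ p n).a' := fun i j hij =>
    sub_le_sub (T.branch_b'_anti N₀ p hij) (T.branch_a'_mono N₀ p hij)
  have hodd : ∀ n, ¬ Even n → (T.branch N₀ p (n + 1)).b' - (T.branch N₀ p (n + 1)).a' ≤
      2 / 3 * ((T.branch N₀ p n).b' - (T.branch N₀ p n).a') := fun n hn => by
    have := T.odd n (T.branch N₀ p n) hn
    rcases T.branch_succ N₀ p n with h | h <;> rw [h]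
    exacts [this.1, this.2]
  refine tendsto_zero_of_two_step hanti (fun n => sub_nonneg.2 (MatchedBox.lt' _).le) fun n => ?_
  by_cases hn : Even n
  · exact (hodd (n + 1) (fun h => Nat.even_add_one.1 h hn)).trans
      (mul_le_mul_of_nonneg_left (hanti (Nat.le_succ n)) (by norm_num))
  · exact (hanti (Nat.le_succ (n + 1))).trans (hodd n hn)

theorem dist_r_le (T : SplitRule l m) (N₀ : MatchedBox l m) (p : MatchedBox l m → Prop) (n : ℕ) :
    dist (T.branch N₀ p n).r (T.branch N₀ p (n + 1)).r ≤ 1 * (1 / 2) ^ n := by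
  have h := T.isSplit n (T.branch N₀ p n)
  rw [dist_comm, Real.dist_eq, one_mul]
  rcases T.branch_succ N₀ p n with h1 | h1 <;> rw [h1]
  exacts [h.left_r, h.right_r]

/-- The branch of boxes whose first side contains `x`. -/
noncomputable abbrev branchAt (T : SplitRule l m) (N₀ : MatchedBox l m) (x : ℝ) :
    ℕ → MatchedBox l m :=
  T.branch N₀ fun N => x < N.b

theorem branchAt_succ_of_lt {x : ℝ} (h : x < (T.left n (T.branchAt N₀ x n)).b) :
    T.branchAt N₀ x (n + 1) = T.left n (T.branchAt N₀ x n) := if_pos h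

theorem branchAt_succ_of_not_lt {x : ℝ} (h : ¬ x < (T.left n (T.branchAt N₀ x n)).b) :
    T.branchAt N₀ x (n + 1) = T.right n (T.branchAt N₀ x n) := if_neg h

theorem mem_branchAt {x : ℝ} (hx : x ∈ Ico N₀.a N₀.b) (n : ℕ) :
    x ∈ Ico (T.branchAt N₀ x n).a (T.branchAt N₀ x n).b := by
  induction n with
  | zero => exact hx
  | succ n ih =>
    have h := T.isSplit n (T.branchAt N₀ x n)
    by_cases hlt : x < (T.left n (T.branchAt N₀ x n)).b
    · rw [branchAt_succ_of_lt hlt]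
      exact ⟨h.left_a.trans_le ih.1, hlt⟩
    · rw [branchAt_succ_of_not_lt hlt]
      exact ⟨h.mid.symm.trans_le (not_lt.1 hlt), ih.2.trans_eq h.right_b.symm⟩

/-- A point lying in a box of some branch has the same boxes down to it. -/
theorem branchAt_eq_branch {z : ℝ} :
    ∀ n, z ∈ Ico (T.branch N₀ p n).a (T.branch N₀ p n).b →
      T.branchAt N₀ z n = T.branch N₀ p n := by
  intro n
  induction n with
  | zero => exact fun _ => rfl
  | succ n ih =>
    intro hz
    have hn := ih ⟨(T.branch_a_mono N₀ p (Nat.le_succ n)).trans hz.1,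
      hz.2.trans_le (T.branch_b_anti N₀ p (Nat.le_succ n))⟩
    have h := T.isSplit n (T.branch N₀ p n)
    by_cases hp : p (T.left n (T.branch N₀ p n))
    · rw [branch_succ_of_pos hp] at hz ⊢
      rw [branchAt_succ_of_lt, hn]
      rw [hn]
      exact hz.2
    · rw [branch_succ_of_neg hp] at hz ⊢
      rw [branchAt_succ_of_not_lt, hn]
      rw [hn, not_lt, h.mid]
      exact hz.1

/-- At the first stage where the branches part, the smaller point goes left and the larger goes
right; later boxes only shrink. -/
theorem branchAt_eq_or_separated {x y : ℝ} (hxy : x < y) (n : ℕ) :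
    T.branchAt N₀ x n = T.branchAt N₀ y n ∨
      (T.branchAt N₀ x n).b' ≤ (T.branchAt N₀ y n).a' := by
  induction n with
  | zero => exact Or.inl rfl
  | succ n ih =>
    rcases ih with ih | ih
    · have h := T.isSplit n (T.branchAt N₀ y n)
      by_cases hy : y < (T.left n (T.branchAt N₀ y n)).b
      · left
        rw [branchAt_succ_of_lt hy, branchAt_succ_of_lt, ih]
        rw [ih]
        exact hxy.trans hy
      · by_cases hx : x < (T.left n (T.branchAt N₀ x n)).b
        · right
          rw [branchAt_succ_of_not_lt hy, branchAt_succ_of_lt hx, ih]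
          exact h.mid'.le
        · left
          rw [branchAt_succ_of_not_lt hy, branchAt_succ_of_not_lt hx, ih]
    · right
      exact ((T.branch_b'_anti N₀ _ (Nat.le_succ n)).trans ih).trans
        (T.branch_a'_mono N₀ _ (Nat.le_succ n))

/-- The branch of boxes whose second side contains a given point. -/
theorem exists_branch_mem {y : ℝ} (hy : y ∈ Ico N₀.a' N₀.b') (T : SplitRule l m) :
    ∃ p : MatchedBox l m → Prop, ∀ n, y ∈ Ico (T.branch N₀ p n).a' (T.branch N₀ p n).b' := by
  refine ⟨fun N => y < N.b', fun n => ?_⟩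
  induction n with
  | zero => exact hy
  | succ n ih =>
    have h := T.isSplit n (T.branch N₀ (fun N => y < N.b') n)
    by_cases hlt : y < (T.left n (T.branch N₀ (fun N => y < N.b') n)).b'
    · rw [branch_succ_of_pos hlt]
      exact ⟨h.left_a'.trans_le ih.1, hlt⟩
    · rw [branch_succ_of_neg hlt]
      exact ⟨h.mid'.symm.trans_le (not_lt.1 hlt), ih.2.trans_eq h.right_b'.symm⟩

end SplitRule

/-! ### Conjugation of height functions -/

/-- Every interval contains `x`, which gives the lower bound; upper semicontinuity at `x` gives the
upper one. -/
theorem IsHairFunction.tendsto_supOn (hl : IsHairFunction l) {a b : ℕ → ℝ}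
    (h : Tendsto (fun n => b n - a n) atTop (𝓝 0)) {x : ℝ} (hx : ∀ n, x ∈ Ico (a n) (b n)) :
    Tendsto (fun n => supOn l (a n) (b n)) atTop (𝓝 (l x)) := by
  refine tendsto_order.2 ⟨fun w hw => Eventually.of_forall fun n =>
    hw.trans_le (hl.le_supOn (Ico_subset_Icc_self (hx n))), fun w hw => ?_⟩
  obtain ⟨v, hv, hvw⟩ := exists_between hw
  obtain ⟨ε, hε, hball⟩ := Metric.eventually_nhds_iff.1 (hl.usc x v hv)
  filter_upwards [h.eventually (gt_mem_nhds hε)] with n hn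
  refine lt_of_le_of_lt (IsHairFunction.supOn_le ((hl.nonneg x).trans hv.le) fun z hz => ?_) hvw
  refine (hball ?_).le
  rw [Real.dist_eq, abs_lt]
  constructor <;> linarith [(hx n).1, (hx n).2, hz.1, hz.2]

/-- Over two matched boxes, two height functions differ by an increasing change of variable and a
continuous positive factor. -/
theorem MatchedBox.exists_conjugation (hl : IsHairFunction l) (hm : IsHairFunction m)
    (N₀ : MatchedBox l m) :
    ∃ φ r : ℝ → ℝ, StrictMonoOn φ (Ico N₀.a N₀.b) ∧ MapsTo φ (Ico N₀.a N₀.b) (Ico N₀.a' N₀.b') ∧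
      SurjOn φ (Ico N₀.a N₀.b) (Ico N₀.a' N₀.b') ∧
      (∀ x ∈ Ico N₀.a N₀.b, m (φ x) = Real.exp (r x) * l x) ∧
      ∀ x ∈ Ico N₀.a N₀.b, x ∈ tsupport l → ContinuousAt r x := by
  obtain ⟨T⟩ := hl.nonempty_splitRule hm
  have hφ : ∀ x, ∃ y, x ∈ Ico N₀.a N₀.b →
      ∀ n, y ∈ Ico (T.branchAt N₀ x n).a' (T.branchAt N₀ x n).b' := by
    intro x
    by_cases hx : x ∈ Ico N₀.a N₀.b
    · obtain ⟨y, hy⟩ := exists_mem_nested (T.branch_a'_mono N₀ fun N => x < N.b)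
        (T.branch_b'_anti N₀ fun N => x < N.b) (fun n => MatchedBox.lt' _)
        (b := fun n => (T.branchAt N₀ x n).b)
        (fun n => by rcases T.branch_step N₀ (fun N => x < N.b) n with h | h <;> tauto)
        (T.tendsto_length N₀ _) (SplitRule.mem_branchAt hx)
      exact ⟨y, fun _ => hy⟩
    · exact ⟨0, fun h => absurd h hx⟩
  choose φ hφ using hφ
  have hr : ∀ x, ∃ r, Tendsto (fun n => (T.branchAt N₀ x n).r) atTop (𝓝 r) := fun x =>
    cauchySeq_tendsto_of_complete
      (cauchySeq_of_le_geometric (1 / 2) 1 (by norm_num) (T.dist_r_le N₀ _))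
  choose r hr using hr
  have hdist : ∀ x n, dist (T.branchAt N₀ x n).r (r x) ≤ 2 * (1 / 2) ^ n := fun x n => by
    refine (dist_le_of_le_geometric_of_tendsto (1 / 2) 1 (by norm_num) (T.dist_r_le N₀ _)
      (hr x) n).trans_eq (by ring)
  refine ⟨φ, r, fun x hx y hy hxy => ?_, fun x hx => hφ x hx 0, fun y hy => ?_, fun x hx => ?_,
    fun x hx hxl => ?_⟩
  · by_cases hall : ∀ n, T.branchAt N₀ x n = T.branchAt N₀ y n
    · refine absurd (eq_of_mem_nested (T.tendsto_length N₀ _) (SplitRule.mem_branchAt hx)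
        fun n => ?_) hxy.ne
      have := SplitRule.mem_branchAt (T := T) hy n
      rwa [← hall n] at this
    · push Not at hall
      obtain ⟨n, hn⟩ := hall
      have := (SplitRule.branchAt_eq_or_separated hxy n).resolve_left hn
      exact (hφ x hx n).2.trans_le (this.trans (hφ y hy n).1)
  · obtain ⟨p, hp⟩ := T.exists_branch_mem hy
    obtain ⟨x, hx⟩ := exists_mem_nested (T.branch_a_mono N₀ p)
        (T.branch_b_anti N₀ p) (fun n => MatchedBox.lt _)
        (b := fun n => (T.branch N₀ p n).b')
        (fun n => by rcases T.branch_step N₀ p n with h | h <;> tauto)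
        (T.tendsto_length' N₀ _) hp
    refine ⟨x, hx 0, eq_of_mem_nested (T.tendsto_length' N₀ p) (fun n => ?_) hp⟩
    have := hφ x (hx 0) n
    rwa [SplitRule.branchAt_eq_branch n (hx n)] at this
  -- Pass to the limit in `supOn_eq` along the branch of `x`.
  · refine tendsto_nhds_unique (hm.tendsto_supOn (T.tendsto_length' N₀ _) (hφ x hx)) ?_
    simp only [MatchedBox.supOn_eq]
    exact ((Real.continuous_exp.tendsto _).comp (hr x)).mul
      (hl.tendsto_supOn (T.tendsto_length N₀ _) (SplitRule.mem_branchAt hx))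
  · rw [Metric.continuousAt_iff']
    intro ε hε
    -- Points in the same box at stage `n` have limits of `r` within `2 * 2⁻ⁿ + 2 * 2⁻ⁿ` of each
    -- other, whence `ε / 4`.
    obtain ⟨n, hn⟩ := exists_pow_lt_of_lt_one (by positivity : 0 < ε / 4)
      (by norm_num : (1 / 2 : ℝ) < 1)
    have hxn := SplitRule.mem_branchAt (T := T) hx n
    -- Since `x` lies in the support, it is not the left end, so the half-open box is a
    -- neighbourhood of `x`.
    have hlt : (T.branchAt N₀ x n).a < x := lt_of_le_of_ne hxn.1 fun h =>
      MatchedBox.a_notMem _ (h ▸ hxl)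
    filter_upwards [Ioo_mem_nhds hlt hxn.2] with z hz
    have heq := SplitRule.branchAt_eq_branch n (Ioo_subset_Ico_self hz)
    have h1 := hdist x n
    have h2 := hdist z n
    rw [heq, dist_comm] at h2
    linarith [dist_triangle (r z) (T.branchAt N₀ x n).r (r x)]

/-- Two height functions are conjugate, near the support, by a homeomorphism of the line and a
continuous positive factor. -/
theorem IsHairFunction.exists_conjugation (hl : IsHairFunction l) (hm : IsHairFunction m) :
    ∃ (φ : ℝ ≃ₜ ℝ) (r : ℝ → ℝ), φ '' tsupport l = tsupport m ∧ Continuous r ∧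
      ∀ x ∈ tsupport l, m (φ x) = Real.exp (r x) * l x := by
  obtain ⟨B, hB⟩ := (hl.hasCompactSupport.isBounded.union
    hm.hasCompactSupport.isBounded).exists_norm_le
  obtain ⟨x₀, hx₀⟩ := hl.exists_pos
  obtain ⟨y₀, hy₀⟩ := hm.exists_pos
  have hx₀' : x₀ ∈ tsupport l := subset_tsupport l hx₀.ne'
  have hy₀' : y₀ ∈ tsupport m := subset_tsupport m hy₀.ne'
  have hB0 : 0 ≤ B := (norm_nonneg _).trans (hB x₀ (Or.inl hx₀'))
  -- One symmetric interval serves both sides, so that `φ` extends by the identity outside it.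
  obtain ⟨R, hR⟩ : ∃ R, B < R := exists_gt B
  have hlR : ∀ x ∈ tsupport l, x ∈ Ioo (-R) R := fun x hx =>
    abs_lt.1 ((hB x (Or.inl hx)).trans_lt hR)
  have hmR : ∀ x ∈ tsupport m, x ∈ Ioo (-R) R := fun x hx =>
    abs_lt.1 ((hB x (Or.inr hx)).trans_lt hR)
  have hlpos : 0 < supOn l (-R) R := hx₀.trans_le (hl.le_supOn (Ioo_subset_Icc_self (hlR _ hx₀')))
  have hmpos : 0 < supOn m (-R) R := hy₀.trans_le (hm.le_supOn (Ioo_subset_Icc_self (hmR _ hy₀')))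
  let N₀ : MatchedBox l m :=
    { a := -R
      b := R
      a' := -R
      b' := R
      r := Real.log (supOn m (-R) R / supOn l (-R) R)
      lt := by linarith
      lt' := by linarith
      a_notMem := fun h => lt_irrefl _ (hlR _ h).1
      b_notMem := fun h => lt_irrefl _ (hlR _ h).2
      a'_notMem := fun h => lt_irrefl _ (hmR _ h).1
      b'_notMem := fun h => lt_irrefl _ (hmR _ h).2
      supOn_eq := by rw [Real.exp_log (by positivity), div_mul_cancel₀ _ hlpos.ne'] }
  obtain ⟨φ, r, hmono, hmaps, hsurj, heq, hr⟩ := N₀.exists_conjugation hl hm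
  change StrictMonoOn φ (Ico (-R) R) at hmono
  change MapsTo φ (Ico (-R) R) (Ico (-R) R) at hmaps
  change SurjOn φ (Ico (-R) R) (Ico (-R) R) at hsurj
  change ∀ x ∈ Ico (-R) R, _ at heq
  change ∀ x ∈ Ico (-R) R, _ at hr
  classical
  have hin : ∀ x ∈ Ico (-R) R, (Ico (-R) R).piecewise φ id x = φ x := fun x hx =>
    piecewise_eq_of_mem _ _ _ hx
  have hout : ∀ x ∉ Ico (-R) R, (Ico (-R) R).piecewise φ id x = x := fun x hx =>
    piecewise_eq_of_notMem _ _ _ hx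
  have hΦ : StrictMono ((Ico (-R) R).piecewise φ id) := by
    intro x y hxy
    by_cases hx : x ∈ Ico (-R) R <;> by_cases hy : y ∈ Ico (-R) R
    · rw [hin x hx, hin y hy]
      exact hmono hx hy hxy
    · rw [hin x hx, hout y hy]
      refine (hmaps hx).2.trans_le (not_lt.1 fun h => hy ⟨hx.1.trans hxy.le, h⟩)
    · rw [hout x hx, hin y hy]
      refine lt_of_lt_of_le (not_le.1 fun h => hx ⟨h, hxy.trans hy.2⟩) (hmaps hy).1
    · rwa [hout x hx, hout y hy]
  have hΦs : Function.Surjective ((Ico (-R) R).piecewise φ id) := by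
    intro y
    by_cases hy : y ∈ Ico (-R) R
    · obtain ⟨x, hx, rfl⟩ := hsurj hy
      exact ⟨x, hin x hx⟩
    · exact ⟨y, hout y hy⟩
  let Φ : ℝ ≃ₜ ℝ := (hΦ.orderIsoOfSurjective _ hΦs).toHomeomorph
  have hΦc : ∀ x, Φ x = (Ico (-R) R).piecewise φ id x := fun x => rfl
  have hl0 : ∀ x ∉ Ico (-R) R, l x = 0 := fun x hx =>
    image_eq_zero_of_notMem_tsupport fun h => hx (Ioo_subset_Ico_self (hlR x h))
  have hm0 : ∀ x ∉ Ico (-R) R, m x = 0 := fun x hx =>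
    image_eq_zero_of_notMem_tsupport fun h => hx (Ioo_subset_Ico_self (hmR x h))
  have hΦeq : ∀ x, m (Φ x) = Real.exp (r x) * l x := by
    intro x
    by_cases hx : x ∈ Ico (-R) R
    · rw [hΦc, hin x hx, heq x hx]
    · rw [hΦc, hout x hx, hl0 x hx, hm0 x hx, mul_zero]
  have hsupp : Φ '' Function.support l = Function.support m := by
    ext y
    obtain ⟨x, rfl⟩ := Φ.surjective y
    rw [Φ.injective.mem_set_image, Function.mem_support, Function.mem_support, hΦeq]
    simp [(Real.exp_pos (r x)).ne']
  have hrc : ContinuousOn r (tsupport l) := fun x hx =>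
    (hr x (Ioo_subset_Ico_self (hlR x hx)) hx).continuousWithinAt
  -- Tietze extension: `r` is known to be continuous only along the support.
  obtain ⟨g, hg⟩ := ContinuousMap.exists_restrict_eq (isClosed_tsupport l)
    ⟨_, hrc.domRestrict⟩
  refine ⟨Φ, g, by rw [tsupport, Φ.image_closure, hsupp, tsupport], g.continuous, fun x hx => ?_⟩
  have : g x = r x := congrArg (fun f : C(tsupport l, ℝ) => f ⟨x, hx⟩) hg
  rw [hΦeq, this]

/-! ### From length functions to height functions -/

namespace IsHairLength

variable {C : Set ℝ} {l : ℝ → ℝ}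

theorem tsupport_indicator (hl : IsHairLength C l) (hC : IsClosed C) :
    tsupport (C.indicator l) = C := by
  refine Subset.antisymm (closure_minimal support_indicator_subset hC)
    (hl.dense_pos.trans (closure_mono ?_))
  rintro x ⟨hx, hpos⟩
  rw [Function.mem_support, indicator_of_mem hx]
  exact hpos.ne'

theorem indicator_nonneg (hl : IsHairLength C l) (x : ℝ) : 0 ≤ C.indicator l x :=
  Set.indicator_nonneg (fun x hx => hl.nonneg x hx) x

/-- A value above `w ≥ 0` is positive, which excludes points off `C` and end points. -/
theorem limsup_eq_of_pos (hl : IsHairLength C l) {x w : ℝ} (hw : w < C.indicator l x)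
    (hw0 : 0 ≤ w) : limsup (fun t => (l t : EReal)) (𝓝[C ∩ Iio x] x) = (l x : EReal) ∧
      limsup (fun t => (l t : EReal)) (𝓝[C ∩ Ioi x] x) = (l x : EReal) ∧ w < l x := by
  have hx : x ∈ C := by
    by_contra hx
    rw [indicator_of_notMem hx] at hw
    exact absurd hw hw0.not_gt
  rw [indicator_of_mem hx] at hw
  have h := hl.not_endPoint x hx fun he => by
    rw [(hl.endPoint x he).1] at hw
    exact absurd hw hw0.not_gt
  exact ⟨h.1, h.2, hw⟩

theorem upperSemicontinuous_indicator (hl : IsHairLength C l) (hC : IsClosed C) :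
    UpperSemicontinuous (C.indicator l) := by
  intro x w hw
  have hw0 : 0 < w := (hl.indicator_nonneg x).trans_lt hw
  by_cases hx : x ∈ C
  · have hlx := hw
    rw [indicator_of_mem hx] at hlx
    -- At an end point the punctured upper limit is zero; elsewhere the two one-sided limits
    -- combine.
    have key : ∀ᶠ y in 𝓝[C \ {x}] x, l y < w := by
      by_cases he : IsEndPoint C x
      · have := eventually_lt_of_limsup_lt
          ((hl.endPoint x he).2.trans_lt (EReal.coe_pos.2 hw0))
        simpa using this
      · have h1 := eventually_lt_of_limsup_lt
          ((hl.not_endPoint x hx he).1.trans_lt (EReal.coe_lt_coe_iff.2 hlx))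
        have h2 := eventually_lt_of_limsup_lt
          ((hl.not_endPoint x hx he).2.trans_lt (EReal.coe_lt_coe_iff.2 hlx))
        have hset : C \ {x} = C ∩ Iio x ∪ C ∩ Ioi x := by
          rw [← inter_union_distrib_left, Iio_union_Ioi, sdiff_eq]
        rw [hset, nhdsWithin_union, eventually_sup]
        exact ⟨by simpa using h1, by simpa using h2⟩
    filter_upwards [eventually_nhdsWithin_iff.1 key] with y hy
    by_cases hyC : y ∈ C
    · rcases eq_or_ne y x with rfl | hyx
      · exact hw
      · rw [indicator_of_mem hyC]
        exact hy ⟨hyC, hyx⟩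
    · rwa [indicator_of_notMem hyC]
  · filter_upwards [hC.isOpen_compl.mem_nhds hx] with y hy
    rwa [indicator_of_notMem hy]

theorem exists_Ioo_lt_indicator_left (hl : IsHairLength C l) {x w z : ℝ}
    (hw : w < C.indicator l x) (hz : z < x) : ∃ y ∈ Ioo z x, w < C.indicator l y := by
  rcases lt_or_ge w 0 with hw0 | hw0
  · obtain ⟨y, hy⟩ := nonempty_Ioo.2 hz
    exact ⟨y, hy, hw0.trans_le (hl.indicator_nonneg y)⟩
  · obtain ⟨h, -, hlx⟩ := hl.limsup_eq_of_pos hw hw0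
    have hf := frequently_lt_of_lt_limsup (by isBoundedDefault)
      ((EReal.coe_lt_coe_iff.2 hlx).trans_eq h.symm)
    obtain ⟨y, hwy, ⟨hyC, hyx⟩, hzy⟩ := (hf.and_eventually
      (eventually_mem_nhdsWithin.and (mem_nhdsWithin_of_mem_nhds (Ioi_mem_nhds hz)))).exists
    exact ⟨y, ⟨hzy, hyx⟩, by rw [indicator_of_mem hyC]; exact EReal.coe_lt_coe_iff.1 hwy⟩

theorem exists_Ioo_lt_indicator_right (hl : IsHairLength C l) {x w z : ℝ}
    (hw : w < C.indicator l x) (hz : x < z) : ∃ y ∈ Ioo x z, w < C.indicator l y := by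
  rcases lt_or_ge w 0 with hw0 | hw0
  · obtain ⟨y, hy⟩ := nonempty_Ioo.2 hz
    exact ⟨y, hy, hw0.trans_le (hl.indicator_nonneg y)⟩
  · obtain ⟨-, h, hlx⟩ := hl.limsup_eq_of_pos hw hw0
    have hf := frequently_lt_of_lt_limsup (by isBoundedDefault)
      ((EReal.coe_lt_coe_iff.2 hlx).trans_eq h.symm)
    obtain ⟨y, hwy, ⟨hyC, hxy⟩, hyz⟩ := (hf.and_eventually
      (eventually_mem_nhdsWithin.and (mem_nhdsWithin_of_mem_nhds (Iio_mem_nhds hz)))).exists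
    exact ⟨y, ⟨hxy, hyz⟩, by rw [indicator_of_mem hyC]; exact EReal.coe_lt_coe_iff.1 hwy⟩

end IsHairLength

theorem IsTotallyDisconnected.dense_compl {C : Set ℝ} (hC : IsTotallyDisconnected C) :
    Dense Cᶜ := by
  refine dense_iff_inter_open.2 fun U hU ⟨x, hx⟩ => ?_
  obtain ⟨ε, hε, hball⟩ := Metric.isOpen_iff.1 hU x hx
  by_contra hne
  have hsub : Metric.ball x ε ⊆ C := fun y hy => by
    by_contra hyC
    exact hne ⟨y, hball hy, hyC⟩
  rw [Real.ball_eq_Ioo] at hsub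
  have h1 : x ∈ Ioo (x - ε) (x + ε) := ⟨by linarith, by linarith⟩
  have h2 : x + ε / 2 ∈ Ioo (x - ε) (x + ε) := ⟨by linarith, by linarith⟩
  have := hC _ hsub isPreconnected_Ioo h1 h2
  linarith

theorem IsHairLength.isHairFunction_indicator {C : Set ℝ} {l : ℝ → ℝ} (hC : IsCantorSet C)
    (hl : IsHairLength C l) : IsHairFunction (C.indicator l) where
  nonneg := hl.indicator_nonneg
  usc := hl.upperSemicontinuous_indicator hC.isCompact.isClosed
  left _ _ hw _ hz := hl.exists_Ioo_lt_indicator_left hw hz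
  right _ _ hw _ hz := hl.exists_Ioo_lt_indicator_right hw hz
  hasCompactSupport := by
    rw [HasCompactSupport, hl.tsupport_indicator hC.isCompact.isClosed]
    exact hC.isCompact
  dense := by
    rw [hl.tsupport_indicator hC.isCompact.isClosed]
    exact hC.totallyDisconnected.dense_compl
  exists_pos := by
    obtain ⟨x, hx, hpos⟩ := closure_nonempty_iff.1 (hC.nonempty.mono hl.dense_pos)
    exact ⟨x, by rwa [indicator_of_mem hx]⟩

/-! ### The homeomorphism of the plane -/

/-- The homeomorphism of the plane that acts by `φ` on the first coordinate and multiplies the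
second coordinate by `exp r`. -/
noncomputable def fiberwiseScaling (φ : ℝ ≃ₜ ℝ) (r : ℝ → ℝ) (hr : Continuous r) :
    (ℝ × ℝ) ≃ₜ (ℝ × ℝ) where
  toFun p := (φ p.1, Real.exp (r p.1) * p.2)
  invFun p := (φ.symm p.1, Real.exp (-r (φ.symm p.1)) * p.2)
  left_inv p := by
    simp only [Homeomorph.symm_apply_apply, ← mul_assoc, ← Real.exp_add, neg_add_cancel,
      Real.exp_zero, one_mul]
  right_inv p := by
    simp only [Homeomorph.apply_symm_apply, ← mul_assoc, ← Real.exp_add, add_neg_cancel,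
      Real.exp_zero, one_mul]
  continuous_toFun := by fun_prop
  continuous_invFun := by fun_prop

theorem theoremT (X Y : Set (ℝ × ℝ)) (hX : IsStraightHairyCantorSet X)
    (hY : IsStraightHairyCantorSet Y) : AmbientlyHomeomorphic X Y := by
  obtain ⟨C, l, hC, hl, rfl⟩ := hX
  obtain ⟨D, m, hD, hm, rfl⟩ := hY
  obtain ⟨φ, r, himage, hr, heq⟩ := (hl.isHairFunction_indicator hC).exists_conjugation
    (hm.isHairFunction_indicator hD)
  rw [hl.tsupport_indicator hC.isCompact.isClosed] at himage heq
  rw [hm.tsupport_indicator hD.isCompact.isClosed] at himage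
  refine ⟨fiberwiseScaling φ r hr, ?_⟩
  ext q
  obtain ⟨⟨x, y⟩, rfl⟩ := (fiberwiseScaling φ r hr).surjective q
  rw [(fiberwiseScaling φ r hr).injective.mem_set_image]
  have hmem : φ x ∈ D ↔ x ∈ C := by rw [← himage, φ.injective.mem_set_image]
  change x ∈ C ∧ 0 ≤ y ∧ y ≤ l x ↔
    φ x ∈ D ∧ 0 ≤ Real.exp (r x) * y ∧ Real.exp (r x) * y ≤ m (φ x)
  rw [hmem, mul_nonneg_iff_of_pos_left (Real.exp_pos _)]
  refine and_congr_right fun hx => and_congr_right fun _ => ?_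
  have := heq x hx
  rw [indicator_of_mem hx, indicator_of_mem (hmem.2 hx)] at this
  rw [this, mul_le_mul_iff_right₀ (Real.exp_pos _)]
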